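/- Let $X \subset \mathbb{R}^{d_x}$ be open, let $f : X \times \mathbb{R}^{d_u} \to \mathbb{R}^{d_x}$, let $\Delta > 0$, and let $\alpha : \mathbb{R}^{d_\omega} \times \mathbb{R}_{\ge 0} \to \mathbb{R}^{d_u}$ be periodic with period $1$ in its second argument. Let $\mathbb{U}$ be the set of Borel measurable, essentially bounded controls $u : \mathbb{R}_{\ge 0} \to \mathbb{R}^{d_u}$. Assume the following. (I) $\alpha$ is measurable; for each $\omega \in \mathbb{R}^{d_\omega}$ the function $\alpha(\omega, \cdot)$ is bounded on $[0,1]$ and right-continuous at $t = 0$; and the family $\{\alpha(\cdot, t) : t \in [0,1)\}$ is equicontinuous at every point of $\mathbb{R}^{d_\omega}$. (II) $f$ is continuously differentiable in $(x,u)$, and for all $x \in X$ and $u \in \mathbb{U}$ there is a function $\xi : \mathbb{R}_{\ge 0} \to X$ such that, for every $t \ge 0$, $s \mapsto f(\xi(s), u(s))$ is integrable on $[0,t]$ and $\xi(t) = x + \int_0^t f(\xi(s), u(s))\,ds$. Then there is a unique function $\varphi : \mathbb{R}_{\ge 0} \times X \times \mathbb{U} \to X$ such that for all $x \in X$ and $u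 \in \mathbb{U}$ the function $\xi = \varphi(\cdot, x, u)$ is a solution in the sense of (II). It is the flow of a time-invariant control system: writing $u^s(t) = u(t+s)$, we have $u^s \in \mathbb{U}$, $\varphi(0,x,u) = x$ and $\varphi(s+t, x, u) = \varphi(t, \varphi(s,x,u), u^s)$ for all $x \in X$, $u \in \mathbb{U}$ and $s,t \ge 0$. Moreover: 1. For every compact $K \subset \mathbb{R}^{d_\omega}$, every control $u$ for which there is a sequence $(\omega_k)_{k \ge 0}$ in $K$ with $u(t) = \alpha(\omega_k, t/\Delta)$ for $k\Delta \le t < (k+1)\Delta$, $k \ge 0$, belongs to $\mathbb{U}$. 2. The function $\Phi : [0,1] \times X \times \mathbb{R}^{d_\omega} \to X$, $\Phi(\tau, x, \omega) = \varphi(\tau\Delta, x, u_\omega)$, where $u_\omega(t) = \alpha(\omega, t/\Delta)$, is right-differentiable in $\tau$ at $\tau = 0$ for every $(x,\omega) \in X \times \mathbb{R}^{d_\omega}$. 3. The function $\Psi : [0,1] \times X \times \mathbb{R}^{d_\omega} \to \mathbb{R}^{d_x}$ given by $\Psi(\tau, x, \omega) = x + \tau^{-1}(\Phi(\tau,x,\omega)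 - x)$ for $\tau \in (0,1]$ and $\Psi(0,x,\omega) = \lim_{t \downarrow 0} \left[x + t^{-1}(\Phi(t,x,\omega) - x)\right]$ is continuous, and it is locally Lipschitz in $x$: for every compact $K \subset X$ there is a locally bounded function $\nu_K : [0,1] \times \mathbb{R}^{d_\omega} \to \mathbb{R}_{\ge 0}$ such that $\|\Psi(\tau, x_2, \omega) - \Psi(\tau, x_1, \omega)\| \le \nu_K(\tau,\omega)\,\|x_2 - x_1\|$ for all $x_1, x_2 \in K$, $\tau \in [0,1]$ and $\omega \in \mathbb{R}^{d_\omega}$. -/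

import Mathlib

open MeasureTheory Set Filter Topology
open scoped NNReal

noncomputable section

/-- `ℝⁿ` with the Euclidean norm. -/
abbrev Vec (n : ℕ) : Type := EuclideanSpace ℝ (Fin n)

/-- The shifted control `u^s`, `u^s(t) = u(t + s)`. -/
def shiftControl {du : ℕ} (s : ℝ≥0) (u : ℝ≥0 → Vec du) : ℝ≥0 → Vec du :=
  fun t => u (t + s)

/-- The Borel measurable, essentially bounded controls `u : ℝ≥0 → ℝ^{du}`. -/
def admissibleControls (du : ℕ) : Set (ℝ≥0 → Vec du) :=
  {u | Measurable u ∧ ∃ C : ℝ, ∀ᵐ t : ℝ, 0 ≤ t → ‖u t.toNNReal‖ ≤ C}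

/-- `ξ : ℝ≥0 → X` solves `ξ' = f(ξ, u)`, `ξ(0) = x` on all of `ℝ≥0`, in the integral sense. -/
def IsSolution {dx du : ℕ} (f : Vec dx → Vec du → Vec dx) (X : Set (Vec dx))
    (x : Vec dx) (u : ℝ≥0 → Vec du) (ξ : ℝ≥0 → Vec dx) : Prop :=
  (∀ t, ξ t ∈ X) ∧
  ∀ t : ℝ≥0,
    IntervalIntegrable (fun s : ℝ => f (ξ s.toNNReal) (u s.toNNReal)) volume 0 t ∧
    ξ t = x + ∫ s in (0 : ℝ)..t, f (ξ s.toNNReal) (u s.toNNReal)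

/-- Every initial state in `X` and every admissible control has a solution on all of `ℝ≥0`. -/
def ForwardComplete {dx du : ℕ} (f : Vec dx → Vec du → Vec dx) (X : Set (Vec dx)) : Prop :=
  ∀ x ∈ X, ∀ u ∈ admissibleControls du, ∃ ξ, IsSolution f X x u ξ

/-- `φ`, considered on `ℝ≥0 × X × admissibleControls du`, is a flow of `ξ' = f(ξ, u)`. -/
def IsODEFlow {dx du : ℕ} (f : Vec dx → Vec du → Vec dx) (X : Set (Vec dx))
    (φ : ℝ≥0 → Vec dx → (ℝ≥0 → Vec du) → Vec dx) : Prop :=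
  ∀ x ∈ X, ∀ u ∈ admissibleControls du, IsSolution f X x u (fun t => φ t x u)

/-- `φ : ℝ≥0 × X × U → X` is the flow function of a time-invariant control system with state
space `X` and set of controls `U`. -/
structure IsControlFlow {dx du : ℕ} (X : Set (Vec dx)) (U : Set (ℝ≥0 → Vec du))
    (φ : ℝ≥0 → Vec dx → (ℝ≥0 → Vec du) → Vec dx) : Prop where
  shift_mem : ∀ u ∈ U, ∀ s, shiftControl s u ∈ U
  maps_to : ∀ t, ∀ x ∈ X, ∀ u ∈ U, φ t x u ∈ X
  identity : ∀ x ∈ X, ∀ u ∈ U, φ 0 x u = x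
  semigroup : ∀ s t, ∀ x ∈ X, ∀ u ∈ U, φ (s + t) x u = φ t (φ s x u) (shiftControl s u)

/-- The set `𝕌(Ω)` of controls `u` for which there is a sequence `ω₀, ω₁, …` in `Ω` with
`u(t) = α(ω_k, t/Δ)` for `kΔ ≤ t < (k+1)Δ`, `k = 0, 1, …`. -/
def controlSet {du dw : ℕ} (α : Vec dw → ℝ≥0 → Vec du) (Δ : ℝ≥0) (Ω : Set (Vec dw)) :
    Set (ℝ≥0 → Vec du) :=
  {u | ∃ ω : ℕ → Vec dw, (∀ k, ω k ∈ Ω) ∧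
    ∀ k : ℕ, ∀ t ∈ Ico (k * Δ) ((k + 1) * Δ), u t = α (ω k) (t / Δ)}

/-- The control `u_ω(t) = α(ω, t/Δ)` generated by the constant sequence with value `ω`. -/
def constControl {du dw : ℕ} (α : Vec dw → ℝ≥0 → Vec du) (Δ : ℝ≥0) (ω : Vec dw) :
    ℝ≥0 → Vec du :=
  fun t => α ω (t / Δ)

/-- `Φ(τ, x, ω) = φ(τΔ, x, u_ω)`. -/
def Phi {dx du dw : ℕ} (φ : ℝ≥0 → Vec dx → (ℝ≥0 → Vec du) → Vec dx)
    (α : Vec dw → ℝ≥0 → Vec du) (Δ : ℝ≥0) (τ : ℝ≥0) (x : Vec dx) (ω : Vec dw) : Vec dx :=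
  φ (τ * Δ) x (constControl α Δ ω)

/-- `Ψ(τ, x, ω) = x + τ⁻¹ (Φ(τ, x, ω) - x)` for `τ > 0`, extended to `τ = 0` by the limit from
the right. -/
def Psi {dx du dw : ℕ} (φ : ℝ≥0 → Vec dx → (ℝ≥0 → Vec du) → Vec dx)
    (α : Vec dw → ℝ≥0 → Vec du) (Δ : ℝ≥0) (τ : ℝ≥0) (x : Vec dx) (ω : Vec dw) : Vec dx :=
  if τ = 0 then
    limUnder (𝓝[>] (0 : ℝ≥0)) (fun t : ℝ≥0 => x + (t : ℝ)⁻¹ • (Phi φ α Δ t x ω - x))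
  else x + (τ : ℝ)⁻¹ • (Phi φ α Δ τ x ω - x)

/-- `ν` is locally bounded on `S`. -/
def LocallyBoundedOn {A : Type*} [TopologicalSpace A] (ν : A → ℝ≥0) (S : Set A) : Prop :=
  ∀ p ∈ S, ∃ C : ℝ≥0, ∀ᶠ q in 𝓝[S] p, ν q ≤ C

/-- The three hypotheses on a flow `φ : ℝ≥0 × X × U → X`. -/
structure FlowHypotheses {dx du dw : ℕ} (X : Set (Vec dx)) (U : Set (ℝ≥0 → Vec du))
    (α : Vec dw → ℝ≥0 → Vec du) (Δ : ℝ≥0)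
    (φ : ℝ≥0 → Vec dx → (ℝ≥0 → Vec du) → Vec dx) : Prop where
  /-- `𝕌(K) ⊆ U` for every compact set `K` of parameters. -/
  controls : ∀ K : Set (Vec dw), IsCompact K → controlSet α Δ K ⊆ U
  /-- `Φ(·, x, ω)` is right-differentiable at `0`. -/
  right_differentiable : ∀ x ∈ X, ∀ ω, ∃ v : Vec dx,
    Tendsto (fun τ : ℝ≥0 => (τ : ℝ)⁻¹ • (Phi φ α Δ τ x ω - Phi φ α Δ 0 x ω))
      (𝓝[>] 0) (𝓝 v)
  /-- `Ψ` is continuous on `[0, 1] × X × ℝ^{dw}`. -/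
  continuous : ContinuousOn (fun p : ℝ≥0 × Vec dx × Vec dw => Psi φ α Δ p.1 p.2.1 p.2.2)
    (Icc 0 1 ×ˢ X ×ˢ univ)
  /-- `Ψ` is locally Lipschitz in `x`: on every compact subset of `X` it is Lipschitz in `x`, with
  a constant that is a locally bounded function of the other variables `(τ, ω)`. -/
  locally_lipschitz : ∀ K ⊆ X, IsCompact K → ∃ ν : ℝ≥0 × Vec dw → ℝ≥0,
    LocallyBoundedOn ν (Icc 0 1 ×ˢ univ) ∧
    ∀ τ ∈ Icc (0 : ℝ≥0) 1, ∀ ω, ∀ x₁ ∈ K, ∀ x₂ ∈ K,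
      ‖Psi φ α Δ τ x₂ ω - Psi φ α Δ τ x₁ ω‖ ≤ ν (τ, ω) * ‖x₂ - x₁‖

end

/-! On a compact subset of `X` times a closed ball of control values, `f` is Lipschitz, and a
trajectory on `[0, T]` under an essentially bounded control meets `f`, for almost every time, only
on such a set. Grönwall's inequality then bounds the distance of two trajectories by the differences
of initial states and controls (`IsSolution.norm_sub_le`). With zero differences this is uniqueness
(`IsSolution.eq`), and uniqueness gives the semigroup law. With small differences, an exit-time
argument keeps nearby solutions in a compact tube (`IsSolution.exists_tube`).

Substituting `s = σΔ`, the quotient `τ⁻¹(Φ(τ,x,ω) - x)` is `Δ` times the average over `σ ∈ [0,τ]` of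
the velocity `f(Φ(σ,x,ω), α(ω,σ))`. Equicontinuity in `ω` and right-continuity of `α` at `0` make
the velocity continuous at `σ = 0` jointly with `(x,ω)`. The averages therefore tend to `Δ f(x,
α(ω,0))` locally uniformly, which gives the right derivative and the continuity of `Ψ` at `τ = 0`;
for `τ > 0` the continuity of `Φ` suffices. Velocities along two trajectories with the same control
differ by at most a constant times `‖x₂ - x₁‖`, and averaging preserves this bound. -/

/-- Grönwall's inequality in integral form. -/
theorem le_mul_exp_of_le_add_integral {g : ℝ → ℝ} (hg : Continuous g) {a L T : ℝ} (hL : 0 ≤ L)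
    (h : ∀ t ∈ Icc 0 T, g t ≤ a + L * ∫ s in (0 : ℝ)..t, g s) :
    ∀ t ∈ Icc 0 T, g t ≤ a * Real.exp (L * t) := by
  have hder : ∀ t, HasDerivAt (fun t => a + L * ∫ s in (0 : ℝ)..t, g s) (L * g t) t := fun t =>
    ((hg.integral_hasStrictDerivAt 0 t).hasDerivAt.const_mul L).const_add a
  intro t ht
  -- The differential form is applied to the right-hand side `G = a + L ∫ g`, which satisfies `G' =
  -- L g ≤ L G`; `g` itself need not be differentiable.
  have key := le_gronwallBound_of_liminf_deriv_right_le (δ := a) (K := L) (ε := 0)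
    (f := fun t => a + L * ∫ s in (0 : ℝ)..t, g s) (f' := fun t => L * g t) (a := 0) (b := T)
    (fun t _ => (hder t).continuousAt.continuousWithinAt)
    (fun t _ r hr => (hder t).hasDerivWithinAt.liminf_right_slope_le hr) (by simp)
    (fun t ht => by
      have := mul_le_mul_of_nonneg_left (h t (Ico_subset_Icc_self ht)) hL
      simpa using this) t ht
  rw [gronwallBound_ε0, sub_zero] at key
  exact (h t ht).trans key

/-- `K` need not be convex, so a derivative bound alone would not do; compactness turns the local
Lipschitz property into a global one. -/
theorem ContDiffOn.exists_lipschitzOnWith_of_isCompact {E F : Type*} [NormedAddCommGroup E]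
    [NormedSpace ℝ E] [NormedAddCommGroup F] [NormedSpace ℝ F] {g : E → F} {U K : Set E}
    (hg : ContDiffOn ℝ 1 g U) (hU : IsOpen U) (hK : IsCompact K) (hKU : K ⊆ U) :
    ∃ L, LipschitzOnWith L g K := by
  refine LocallyLipschitzOn.exists_lipschitzOnWith_of_compact hK fun x hx => ?_
  obtain ⟨L, t, ht, hL⟩ :=
    (hg.contDiffAt (hU.mem_nhds (hKU hx))).exists_lipschitzOnWith
  exact ⟨L, t, mem_nhdsWithin_of_mem_nhds ht, hL⟩

/-! ### Uniqueness and continuous dependence of solutions. -/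

section Solutions

variable {dx du : ℕ} {f : Vec dx → Vec du → Vec dx} {X : Set (Vec dx)}

theorem IsSolution.zero {x : Vec dx} {u : ℝ≥0 → Vec du} {ξ : ℝ≥0 → Vec dx}
    (h : IsSolution f X x u ξ) : ξ 0 = x := by
  simpa using (h.2 0).2

theorem IsSolution.continuous {x : Vec dx} {u : ℝ≥0 → Vec du} {ξ : ℝ≥0 → Vec dx}
    (h : IsSolution f X x u ξ) : Continuous ξ := by
  rw [continuous_iff_continuousAt]
  intro t₀
  -- Ending at `t₀ + 1` makes `t₀` interior to the interval on which the primitive is continuous.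
  have hint := (h.2 (t₀ + 1)).1
  have hc := intervalIntegral.continuousOn_primitive_interval' hint left_mem_uIcc
  rw [uIcc_of_le (by positivity)] at hc
  have hc' : ContinuousOn (fun t : ℝ≥0 =>
      x + ∫ s in (0 : ℝ)..t, f (ξ s.toNNReal) (u s.toNNReal)) (Iic (t₀ + 1)) :=
    continuousOn_const.add (hc.comp NNReal.continuous_coe.continuousOn
      fun t ht => ⟨t.2, NNReal.coe_le_coe.2 ht⟩)
  have := hc'.continuousAt (x := t₀) (Iic_mem_nhds (lt_add_one t₀))
  exact this.congr (Eventually.of_forall fun t => ((h.2 t).2).symm)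

theorem IsSolution.norm_sub_sub_smul_le {x v : Vec dx} {u : ℝ≥0 → Vec du} {ξ : ℝ≥0 → Vec dx}
    (h : IsSolution f X x u ξ) {t : ℝ≥0} {ε : ℝ} (hv : ∀ s ≤ t, ‖f (ξ s) (u s) - v‖ ≤ ε) :
    ‖ξ t - x - (t : ℝ) • v‖ ≤ ε * t := by
  have h1 : ξ t - x - (t : ℝ) • v
      = ∫ s in (0 : ℝ)..t, (f (ξ s.toNNReal) (u s.toNNReal) - v) := by
    rw [intervalIntegral.integral_sub (h.2 t).1 intervalIntegrable_const, (h.2 t).2]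
    simp
  rw [h1]
  have := intervalIntegral.norm_integral_le_of_norm_le_const (a := 0) (b := (t : ℝ)) (C := ε)
    (f := fun s : ℝ => f (ξ s.toNNReal) (u s.toNNReal) - v) fun s hs => by
      rw [uIoc_of_le (NNReal.coe_nonneg t)] at hs
      exact hv _ (Real.toNNReal_le_iff_le_coe.2 hs.2)
  simpa using this

/-- Comparing increments instead of states leaves the factor `t`, which survives the later division
by `τ`. -/
theorem IsSolution.norm_sub_sub_sub_le {x y : Vec dx} {u w : ℝ≥0 → Vec du} {ξ ζ : ℝ≥0 → Vec dx}
    (h : IsSolution f X x u ξ) (h' : IsSolution f X y w ζ) {t : ℝ≥0} {D : ℝ}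
    (hD : ∀ s ≤ t, ‖f (ξ s) (u s) - f (ζ s) (w s)‖ ≤ D) :
    ‖(ξ t - x) - (ζ t - y)‖ ≤ D * t := by
  have h1 : (ξ t - x) - (ζ t - y)
      = ∫ s in (0 : ℝ)..t,
          (f (ξ s.toNNReal) (u s.toNNReal) - f (ζ s.toNNReal) (w s.toNNReal)) := by
    rw [intervalIntegral.integral_sub (h.2 t).1 (h'.2 t).1, (h.2 t).2, (h'.2 t).2]
    simp
  rw [h1]
  have := intervalIntegral.norm_integral_le_of_norm_le_const (a := 0) (b := (t : ℝ)) (C := D)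
    (f := fun s : ℝ => f (ξ s.toNNReal) (u s.toNNReal) - f (ζ s.toNNReal) (w s.toNNReal))
    fun s hs => by
      rw [uIoc_of_le (NNReal.coe_nonneg t)] at hs
      exact hD _ (Real.toNNReal_le_iff_le_coe.2 hs.2)
  simpa using this

theorem LipschitzOnWith.norm_sub_le_add {K : Set (Vec dx)} {B : Set (Vec du)} {L : ℝ≥0}
    (hL : LipschitzOnWith L (fun p : Vec dx × Vec du => f p.1 p.2) (K ×ˢ B))
    {x y : Vec dx} {v w : Vec du} (hx : x ∈ K) (hy : y ∈ K) (hv : v ∈ B) (hw : w ∈ B) :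
    ‖f x v - f y w‖ ≤ L * (‖x - y‖ + ‖v - w‖) := by
  have := hL.norm_sub_le (x := (x, v)) (y := (y, w)) ⟨hx, hv⟩ ⟨hy, hw⟩
  refine this.trans (mul_le_mul_of_nonneg_left ?_ L.2)
  rw [Prod.mk_sub_mk, Prod.norm_mk]
  exact max_le_add_of_nonneg (norm_nonneg _) (norm_nonneg _)

/-- Two solutions that stay in a set where `f` is Lipschitz are close when their initial values and
their controls are. -/
theorem IsSolution.norm_sub_le {K : Set (Vec dx)} {B : Set (Vec du)} {L : ℝ≥0}
    (hL : LipschitzOnWith L (fun p : Vec dx × Vec du => f p.1 p.2) (K ×ˢ B))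
    {x y : Vec dx} {u w : ℝ≥0 → Vec du} {ξ ζ : ℝ≥0 → Vec dx}
    (h : IsSolution f X x u ξ) (h' : IsSolution f X y w ζ) {T : ℝ≥0}
    (hξ : ∀ t ≤ T, ξ t ∈ K) (hζ : ∀ t ≤ T, ζ t ∈ K)
    (hu : ∀ᵐ t : ℝ, 0 ≤ t → u t.toNNReal ∈ B) (hw : ∀ᵐ t : ℝ, 0 ≤ t → w t.toNNReal ∈ B)
    {δ : ℝ} (hδ : ∀ᵐ t : ℝ, 0 ≤ t → ‖u t.toNNReal - w t.toNNReal‖ ≤ δ) (hδ0 : 0 ≤ δ) :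
    ∀ t ≤ T, ‖ξ t - ζ t‖ ≤ (‖x - y‖ + L * δ * T) * Real.exp (L * t) := by
  set g : ℝ → ℝ := fun r => ‖ξ r.toNNReal - ζ r.toNNReal‖ with hgdef
  have hg : Continuous g := ((h.continuous.comp continuous_real_toNNReal).sub
    (h'.continuous.comp continuous_real_toNNReal)).norm
  have key : ∀ r ∈ Icc (0 : ℝ) T,
      g r ≤ (‖x - y‖ + L * δ * T) + L * ∫ s in (0 : ℝ)..r, g s := by
    intro r hr
    have hgr : g r = ‖(x - y) + ∫ s in (0 : ℝ)..r,
        (f (ξ s.toNNReal) (u s.toNNReal) - f (ζ s.toNNReal) (w s.toNNReal))‖ := by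
      have e1 := h.2 r.toNNReal
      have e2 := h'.2 r.toNNReal
      rw [Real.coe_toNNReal r hr.1] at e1 e2
      rw [intervalIntegral.integral_sub e1.1 e2.1, hgdef]
      simp only
      rw [e1.2, e2.2]
      congr 1
      abel
    have hint : ‖∫ s in (0 : ℝ)..r,
        (f (ξ s.toNNReal) (u s.toNNReal) - f (ζ s.toNNReal) (w s.toNNReal))‖
        ≤ ∫ s in (0 : ℝ)..r, (L * (g s + δ) : ℝ) := by
      refine intervalIntegral.norm_integral_le_of_norm_le hr.1 ?_
        ((continuous_const.mul (hg.add continuous_const)).intervalIntegrable _ _)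
      filter_upwards [hu, hw, hδ] with s h1 h2 h3 hs
      have hs0 : 0 ≤ s := hs.1.le
      have hsT : s.toNNReal ≤ T := Real.toNNReal_le_iff_le_coe.2 (hs.2.trans hr.2)
      refine (hL.norm_sub_le_add (hξ _ hsT) (hζ _ hsT) (h1 hs0) (h2 hs0)).trans ?_
      exact mul_le_mul_of_nonneg_left (add_le_add_right (h3 hs0) _) L.2
    have hI : ∫ s in (0 : ℝ)..r, (L * (g s + δ) : ℝ)
        = L * (∫ s in (0 : ℝ)..r, g s) + L * δ * r := by
      rw [intervalIntegral.integral_const_mul, intervalIntegral.integral_add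
        (hg.intervalIntegrable _ _) intervalIntegrable_const, intervalIntegral.integral_const]
      simp only [sub_zero, smul_eq_mul]
      ring
    -- The control error is enlarged to its value at `T`, as Grönwall's inequality is used with a
    -- constant term.
    have h4 : (L : ℝ) * δ * r ≤ L * δ * T :=
      mul_le_mul_of_nonneg_left hr.2 (mul_nonneg L.2 hδ0)
    rw [hgr]
    have := norm_add_le (x - y) (∫ s in (0 : ℝ)..r,
        (f (ξ s.toNNReal) (u s.toNNReal) - f (ζ s.toNNReal) (w s.toNNReal)))
    linarith
  intro t ht
  have := le_mul_exp_of_le_add_integral hg L.2 key t ⟨t.2, NNReal.coe_le_coe.2 ht⟩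
  simpa [hgdef] using this

theorem exists_lipschitzOnWith_prod_closedBall (hX : IsOpen X)
    (hf : ContDiffOn ℝ 1 (fun p : Vec dx × Vec du => f p.1 p.2) (X ×ˢ univ))
    {K : Set (Vec dx)} (hK : IsCompact K) (hKX : K ⊆ X) (C : ℝ) :
    ∃ L, LipschitzOnWith L (fun p : Vec dx × Vec du => f p.1 p.2)
      (K ×ˢ Metric.closedBall (0 : Vec du) C) :=
  hf.exists_lipschitzOnWith_of_isCompact (hX.prod isOpen_univ)
    (hK.prod (isCompact_closedBall _ _)) (prod_mono hKX (subset_univ _))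

theorem IsSolution.eq (hX : IsOpen X)
    (hf : ContDiffOn ℝ 1 (fun p : Vec dx × Vec du => f p.1 p.2) (X ×ˢ univ))
    {x : Vec dx} {u : ℝ≥0 → Vec du} (hu : u ∈ admissibleControls du) {ξ ζ : ℝ≥0 → Vec dx}
    (h : IsSolution f X x u ξ) (h' : IsSolution f X x u ζ) : ξ = ζ := by
  funext T
  obtain ⟨C, hC⟩ := hu.2
  have hK : IsCompact (ξ '' Icc 0 T ∪ ζ '' Icc 0 T) :=
    (isCompact_Icc.image h.continuous).union (isCompact_Icc.image h'.continuous)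
  have hKX : ξ '' Icc 0 T ∪ ζ '' Icc 0 T ⊆ X :=
    union_subset (image_subset_iff.2 fun t _ => h.1 t) (image_subset_iff.2 fun t _ => h'.1 t)
  obtain ⟨L, hL⟩ := exists_lipschitzOnWith_prod_closedBall hX hf hK hKX C
  have hB : ∀ᵐ t : ℝ, 0 ≤ t → u t.toNNReal ∈ Metric.closedBall (0 : Vec du) C := by
    simpa using hC
  have := h.norm_sub_le hL h' (T := T)
    (fun t ht => Or.inl ⟨t, ⟨zero_le, ht⟩, rfl⟩)
    (fun t ht => Or.inr ⟨t, ⟨zero_le, ht⟩, rfl⟩) hB hB (δ := 0) (by simp) le_rfl T le_rfl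
  simpa [sub_eq_zero] using this

/-- Continuous dependence on the initial value and the control, uniformly on `[0, T]`. -/
theorem IsSolution.exists_tube (hX : IsOpen X)
    (hf : ContDiffOn ℝ 1 (fun p : Vec dx × Vec du => f p.1 p.2) (X ×ˢ univ))
    {x₀ : Vec dx} {u₀ : ℝ≥0 → Vec du} {ξ₀ : ℝ≥0 → Vec dx} (h₀ : IsSolution f X x₀ u₀ ξ₀)
    {C : ℝ} (hu₀ : ∀ᵐ t : ℝ, 0 ≤ t → ‖u₀ t.toNNReal‖ ≤ C) (T : ℝ≥0) :
    ∃ K ⊆ X, IsCompact K ∧ ∃ M : ℝ, ∃ η > 0, ∀ δ : ℝ, 0 ≤ δ → δ ≤ η → ∀ x u ξ,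
      IsSolution f X x u ξ → ‖x - x₀‖ ≤ δ →
      (∀ᵐ t : ℝ, 0 ≤ t → ‖u t.toNNReal - u₀ t.toNNReal‖ ≤ δ) →
      ∀ t ≤ T, ξ t ∈ K ∧ ‖ξ t - ξ₀ t‖ ≤ M * δ := by
  have hK₀ : IsCompact (ξ₀ '' Icc 0 T) := isCompact_Icc.image h₀.continuous
  obtain ⟨ε, hε, hεX⟩ := hK₀.exists_cthickening_subset_open hX
    (image_subset_iff.2 fun t _ => h₀.1 t)
  have hKc : IsCompact (Metric.cthickening ε (ξ₀ '' Icc 0 T)) := hK₀.cthickening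
  obtain ⟨L, hL⟩ := exists_lipschitzOnWith_prod_closedBall hX hf hKc hεX (C + 1)
  set M : ℝ := (1 + L * T) * Real.exp (L * T) with hM
  have hLT : (0 : ℝ) ≤ L * T := by positivity
  have hM1 : 1 ≤ M := by
    have := Real.one_le_exp hLT
    nlinarith
  -- The bound `1` keeps control values in the ball of radius `C + 1`; the bound `ε / (2M)` makes `M
  -- δ` strictly less than `ε`.
  refine ⟨_, hεX, hKc, M, min 1 (ε / (2 * M)), by positivity, ?_⟩
  intro δ hδ0 hδη x u ξ h hx hu
  have hδ1 : δ ≤ 1 := hδη.trans (min_le_left _ _)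
  have hMδ : M * δ < ε := by
    have : δ ≤ ε / (2 * M) := hδη.trans (min_le_right _ _)
    rw [le_div_iff₀ (by positivity)] at this
    nlinarith
  have hmem : ∀ t ≤ T, ‖ξ t - ξ₀ t‖ ≤ ε → ξ t ∈ Metric.cthickening ε (ξ₀ '' Icc 0 T) :=
    fun t ht h1 => Metric.mem_cthickening_of_dist_le _ (ξ₀ t) _ _ ⟨t, ⟨zero_le, ht⟩, rfl⟩
      (by rwa [dist_eq_norm])
  have hB₀ : ∀ᵐ t : ℝ, 0 ≤ t → u₀ t.toNNReal ∈ Metric.closedBall (0 : Vec du) (C + 1) := by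
    filter_upwards [hu₀] with t h1 h2
    rw [mem_closedBall_zero_iff]
    linarith [h1 h2]
  have hB : ∀ᵐ t : ℝ, 0 ≤ t → u t.toNNReal ∈ Metric.closedBall (0 : Vec du) (C + 1) := by
    filter_upwards [hu₀, hu] with t h1 h3 h2
    rw [mem_closedBall_zero_iff]
    have := norm_le_norm_add_norm_sub' (u t.toNNReal) (u₀ t.toNNReal)
    linarith [h1 h2, h3 h2]
  -- Bootstrap: distance at most `ε` up to `S` improves to `M δ < ε`, so there is no first time `t₁`
  -- at which `ε` is reached.
  have step : ∀ S ≤ T, (∀ t ≤ S, ‖ξ t - ξ₀ t‖ ≤ ε) → ‖ξ S - ξ₀ S‖ ≤ M * δ := by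
    intro S hS hle
    have h1 := h.norm_sub_le hL h₀ (T := S) (fun t ht => hmem t (ht.trans hS) (hle t ht))
      (fun t ht => Metric.self_subset_cthickening _ ⟨t, ⟨zero_le, ht.trans hS⟩, rfl⟩) hB hB₀ hu hδ0 S le_rfl
    refine h1.trans ?_
    have hST : (S : ℝ) ≤ T := NNReal.coe_le_coe.2 hS
    calc (‖x - x₀‖ + L * δ * S) * Real.exp (L * S)
        ≤ (δ + L * δ * T) * Real.exp (L * T) := by gcongr
      _ = M * δ := by rw [hM]; ring
  have hcont : Continuous fun t => ‖ξ t - ξ₀ t‖ := (h.continuous.sub h₀.continuous).norm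
  have hlt : ∀ t ≤ T, ‖ξ t - ξ₀ t‖ < ε := by
    by_contra! hcon
    obtain ⟨t₁, ⟨ht₁T, ht₁⟩, hmin⟩ :=
      (isCompact_Icc.inter_right (isClosed_le continuous_const hcont) :
        IsCompact (Icc 0 T ∩ {t | ε ≤ ‖ξ t - ξ₀ t‖})).exists_isLeast
        (by obtain ⟨t, h1, h2⟩ := hcon; exact ⟨t, ⟨zero_le, h1⟩, h2⟩)
    have hbelow : Iio t₁ ⊆ {t | ‖ξ t - ξ₀ t‖ ≤ ε} := fun t ht => by
      by_contra hc
      exact absurd (hmin ⟨⟨zero_le, (le_of_lt ht).trans ht₁T.2⟩, (not_le.1 (show ¬ ‖ξ t - ξ₀ t‖ ≤ ε from hc)).le⟩) (not_le.2 ht)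
    have hIic : ∀ t ≤ t₁, ‖ξ t - ξ₀ t‖ ≤ ε := by
      -- For `t₁ = 0` the closure of `Iio t₁` is empty, so the initial values are compared directly,
      -- using `1 ≤ M`.
      rcases eq_or_ne t₁ 0 with h0 | h0
      · intro t ht
        rw [h0, nonpos_iff_eq_zero] at ht
        rw [ht, h.zero, h₀.zero]
        nlinarith
      · have := closure_minimal hbelow (isClosed_le hcont continuous_const)
        rw [closure_Iio' ⟨0, pos_iff_ne_zero.2 h0⟩] at this
        exact this
    have := step t₁ ht₁T.2 hIic
    have h2 : ε ≤ ‖ξ t₁ - ξ₀ t₁‖ := ht₁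
    linarith
  intro t ht
  exact ⟨hmem t ht (hlt t ht).le, step t ht fun s hs => (hlt s (hs.trans ht)).le⟩

end Solutions

theorem Real.toNNReal_add_coe {r : ℝ} (hr : 0 ≤ r) (s : ℝ≥0) :
    (r + s).toNNReal = r.toNNReal + s := by
  rw [Real.toNNReal_add hr s.coe_nonneg, Real.toNNReal_coe]

/-! ### Periodic control families and admissibility. -/

section Controls

variable {du dw : ℕ} {α : Vec dw → ℝ≥0 → Vec du}

/-- One `r`, the fractional part of `t`, serves all `ω`; hence comparisons between parameters also
extend from one period to all times. -/
theorem exists_mem_Ico_forall_eq_of_periodic (hper : ∀ ω, Function.Periodic (α ω) 1) (t : ℝ≥0) :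
    ∃ r ∈ Ico (0 : ℝ≥0) 1, ∀ ω, α ω t = α ω r := by
  have hle : (⌊t⌋₊ : ℝ≥0) ≤ t := Nat.floor_le zero_le
  have hadd : t - ⌊t⌋₊ + ⌊t⌋₊ = t := tsub_add_cancel_of_le hle
  refine ⟨t - ⌊t⌋₊, ⟨zero_le, ?_⟩, fun ω => ?_⟩
  · rw [tsub_lt_iff_left hle]
    exact Nat.lt_floor_add_one t
  · have := (hper ω).nat_mul ⌊t⌋₊ (t - ⌊t⌋₊)
    rwa [mul_one, hadd] at this

theorem exists_forall_norm_le_of_periodic (hper : ∀ ω, Function.Periodic (α ω) 1)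
    (hbdd : ∀ ω, Bornology.IsBounded (α ω '' Icc 0 1)) (ω : Vec dw) :
    ∃ C, ∀ t, ‖α ω t‖ ≤ C := by
  obtain ⟨C, hC⟩ := (hbdd ω).exists_norm_le
  refine ⟨C, fun t => ?_⟩
  obtain ⟨r, hr, h⟩ := exists_mem_Ico_forall_eq_of_periodic hper t
  rw [h]
  exact hC _ ⟨r, Ico_subset_Icc_self hr, rfl⟩

theorem eventually_forall_norm_sub_lt_of_periodic (hper : ∀ ω, Function.Periodic (α ω) 1)
    (heq : Equicontinuous (fun (t : Ico (0 : ℝ≥0) 1) (ω : Vec dw) => α ω t)) (ω₀ : Vec dw)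
    {ε : ℝ} (hε : 0 < ε) : ∀ᶠ ω in 𝓝 ω₀, ∀ t, ‖α ω t - α ω₀ t‖ < ε := by
  filter_upwards [Metric.equicontinuousAt_iff_right.1 (heq ω₀) ε hε] with ω hω t
  obtain ⟨r, hr, h⟩ := exists_mem_Ico_forall_eq_of_periodic hper t
  rw [h, h, ← dist_eq_norm, dist_comm]
  exact hω ⟨r, hr⟩

theorem exists_eventually_forall_norm_le_of_periodic (hper : ∀ ω, Function.Periodic (α ω) 1)
    (hbdd : ∀ ω, Bornology.IsBounded (α ω '' Icc 0 1))
    (heq : Equicontinuous (fun (t : Ico (0 : ℝ≥0) 1) (ω : Vec dw) => α ω t)) (ω₀ : Vec dw) :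
    ∃ C, ∀ᶠ ω in 𝓝 ω₀, ∀ t, ‖α ω t‖ ≤ C := by
  obtain ⟨C, hC⟩ := exists_forall_norm_le_of_periodic hper hbdd ω₀
  refine ⟨C + 1, ?_⟩
  filter_upwards [eventually_forall_norm_sub_lt_of_periodic hper heq ω₀ one_pos] with ω hω t
  linarith [hω t, hC t, norm_le_norm_add_norm_sub' (α ω t) (α ω₀ t)]

theorem IsCompact.exists_forall_norm_le_of_periodic (hper : ∀ ω, Function.Periodic (α ω) 1)
    (hbdd : ∀ ω, Bornology.IsBounded (α ω '' Icc 0 1))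
    (heq : Equicontinuous (fun (t : Ico (0 : ℝ≥0) 1) (ω : Vec dw) => α ω t))
    {K : Set (Vec dw)} (hK : IsCompact K) : ∃ C, ∀ ω ∈ K, ∀ t, ‖α ω t‖ ≤ C := by
  refine hK.induction_on (p := fun s => ∃ C, ∀ ω ∈ s, ∀ t, ‖α ω t‖ ≤ C) (by simp)
    (fun s t hst ⟨C, hC⟩ => ⟨C, fun ω hω => hC ω (hst hω)⟩) ?_ fun ω₀ _ => ?_
  · rintro s t ⟨C, hC⟩ ⟨D, hD⟩
    refine ⟨max C D, ?_⟩
    rintro ω (hω | hω) r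
    exacts [(hC ω hω r).trans (le_max_left _ _), (hD ω hω r).trans (le_max_right _ _)]
  · obtain ⟨C, hC⟩ := exists_eventually_forall_norm_le_of_periodic hper hbdd heq ω₀
    exact ⟨_, mem_nhdsWithin_of_mem_nhds hC, C, fun ω hω => hω⟩

theorem shiftControl_mem_admissibleControls {u : ℝ≥0 → Vec du} (hu : u ∈ admissibleControls du)
    (s : ℝ≥0) : shiftControl s u ∈ admissibleControls du := by
  obtain ⟨hm, C, hC⟩ := hu
  refine ⟨hm.comp (measurable_id.add_const s), C, ?_⟩
  have := (measurePreserving_add_right (volume : Measure ℝ) (s : ℝ)).quasiMeasurePreserving.ae hC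
  filter_upwards [this] with t ht h0
  have := ht (add_nonneg h0 s.2)
  rwa [Real.toNNReal_add_coe h0] at this

theorem controlSet_subset_admissibleControls (hper : ∀ ω, Function.Periodic (α ω) 1)
    (hmeas : Measurable (Function.uncurry α))
    (hbdd : ∀ ω, Bornology.IsBounded (α ω '' Icc 0 1))
    (heq : Equicontinuous (fun (t : Ico (0 : ℝ≥0) 1) (ω : Vec dw) => α ω t))
    {Δ : ℝ≥0} (hΔ : 0 < Δ) {K : Set (Vec dw)} (hK : IsCompact K) :
    controlSet α Δ K ⊆ admissibleControls du := by
  rintro u ⟨ω, hω, hu⟩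
  -- The index of the sampling interval containing `t` is `⌊t / Δ⌋₊`, so `u` is a composition of
  -- measurable maps.
  have hu' : ∀ t, u t = α (ω ⌊t / Δ⌋₊) (t / Δ) := fun t => by
    refine hu _ t ⟨?_, ?_⟩
    · exact (le_div_iff₀ hΔ).1 (Nat.floor_le zero_le)
    · exact (div_lt_iff₀ hΔ).1 (Nat.lt_floor_add_one _)
  obtain ⟨C, hC⟩ := hK.exists_forall_norm_le_of_periodic hper hbdd heq
  refine ⟨?_, C, Eventually.of_forall fun t _ => by rw [hu']; exact hC _ (hω _) _⟩
  have hdiv : Measurable fun t : ℝ≥0 => t / Δ := measurable_id.div_const Δ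
  have : u = Function.uncurry α ∘ fun t => (ω ⌊t / Δ⌋₊, t / Δ) := funext hu'
  rw [this]
  exact hmeas.comp (((measurable_from_nat (f := ω)).comp (Nat.measurable_floor.comp hdiv)).prodMk
    hdiv)

theorem constControl_mem_admissibleControls (hper : ∀ ω, Function.Periodic (α ω) 1)
    (hmeas : Measurable (Function.uncurry α))
    (hbdd : ∀ ω, Bornology.IsBounded (α ω '' Icc 0 1)) (Δ : ℝ≥0) (ω : Vec dw) :
    constControl α Δ ω ∈ admissibleControls du := by
  obtain ⟨C, hC⟩ := exists_forall_norm_le_of_periodic hper hbdd ω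
  exact ⟨hmeas.comp (measurable_const.prodMk (measurable_id.div_const Δ)), C,
    Eventually.of_forall fun t _ => hC _⟩

end Controls

/-! ### Existence of the flow and the semigroup law. -/

section Flow

variable {dx du : ℕ} {f : Vec dx → Vec du → Vec dx} {X : Set (Vec dx)}

theorem IsSolution.shift {x : Vec dx} {u : ℝ≥0 → Vec du} {ξ : ℝ≥0 → Vec dx}
    (h : IsSolution f X x u ξ) (s : ℝ≥0) :
    IsSolution f X (ξ s) (shiftControl s u) (fun t => ξ (s + t)) := by
  refine ⟨fun t => h.1 _, fun t => ?_⟩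
  set F : ℝ → Vec dx := fun r => f (ξ r.toNNReal) (u r.toNNReal) with hF
  have hEq : EqOn (fun r : ℝ => f (ξ (s + r.toNNReal)) (shiftControl s u r.toNNReal))
      (fun r => F (r + s)) (uIcc 0 t) := fun r hr => by
    rw [uIcc_of_le (NNReal.coe_nonneg t)] at hr
    simp only [hF, shiftControl, Real.toNNReal_add_coe hr.1, add_comm s]
  have h0s := (h.2 s).1
  have h0st : IntervalIntegrable F volume 0 (t + s : ℝ) := by
    have := (h.2 (t + s)).1
    rwa [NNReal.coe_add] at this
  have hs := h0s.symm.trans h0st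
  constructor
  · have := hs.comp_add_right (s : ℝ)
    rw [sub_self, add_sub_cancel_right] at this
    exact this.congr (hEq.symm.mono uIoc_subset_uIcc)
  · rw [intervalIntegral.integral_congr hEq, intervalIntegral.integral_comp_add_right, zero_add]
    simp only [add_comm s t]
    rw [(h.2 s).2, (h.2 (t + s)).2, NNReal.coe_add, add_assoc,
      intervalIntegral.integral_add_adjacent_intervals h0s hs]

theorem ForwardComplete.exists_isODEFlow (h : ForwardComplete f X) : ∃ φ, IsODEFlow f X φ := by
  classical
  choose ξ hξ using h
  refine ⟨fun t x u => if hx : x ∈ X then if hu : u ∈ admissibleControls du then ξ x hx u hu t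
    else x else x, fun x hx u hu => ?_⟩
  simpa [hx, hu] using hξ x hx u hu

/-- The tail of a trajectory solves the equation with the shifted control, so uniqueness identifies
it with the flow started at `φ s x u`. -/
theorem IsODEFlow.isControlFlow (hX : IsOpen X)
    (hf : ContDiffOn ℝ 1 (fun p : Vec dx × Vec du => f p.1 p.2) (X ×ˢ univ))
    {φ : ℝ≥0 → Vec dx → (ℝ≥0 → Vec du) → Vec dx} (hφ : IsODEFlow f X φ) :
    IsControlFlow X (admissibleControls du) φ where
  shift_mem u hu s := shiftControl_mem_admissibleControls hu s
  maps_to t x hx u hu := (hφ x hx u hu).1 t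
  identity x hx u hu := (hφ x hx u hu).zero
  semigroup s t x hx u hu := by
    have hu' := shiftControl_mem_admissibleControls hu s
    exact congrFun (((hφ x hx u hu).shift s).eq hX hf hu'
      (hφ _ ((hφ x hx u hu).1 s) _ hu')) t

end Flow

/-! ### Continuity and Lipschitz properties of `Φ` and `Ψ`. -/

section Sampled

variable {dx du dw : ℕ} {X : Set (Vec dx)} {f : Vec dx → Vec du → Vec dx} {Δ : ℝ≥0}
  {α : Vec dw → ℝ≥0 → Vec du} {φ : ℝ≥0 → Vec dx → (ℝ≥0 → Vec du) → Vec dx}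

/-- The part of the standing assumptions that concerns the sampled solutions `Φ(·, x, ω)`. -/
structure SampledSystem (X : Set (Vec dx)) (f : Vec dx → Vec du → Vec dx) (Δ : ℝ≥0)
    (α : Vec dw → ℝ≥0 → Vec du) (φ : ℝ≥0 → Vec dx → (ℝ≥0 → Vec du) → Vec dx) : Prop where
  isOpen : IsOpen X
  contDiffOn : ContDiffOn ℝ 1 (fun p : Vec dx × Vec du => f p.1 p.2) (X ×ˢ univ)
  pos : 0 < Δ
  exists_norm_le : ∀ ω, ∃ C, ∀ t, ‖α ω t‖ ≤ C
  right_continuous : ∀ ω, ContinuousAt (α ω) 0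
  eventually_norm_sub_lt : ∀ ω₀, ∀ ε : ℝ, 0 < ε → ∀ᶠ ω in 𝓝 ω₀, ∀ t, ‖α ω t - α ω₀ t‖ < ε
  isSolution : ∀ x ∈ X, ∀ ω, IsSolution f X x (constControl α Δ ω)
    (fun t => φ t x (constControl α Δ ω))

namespace SampledSystem

theorem Phi_zero (H : SampledSystem X f Δ α φ) {x : Vec dx} (hx : x ∈ X) (ω : Vec dw) :
    Phi φ α Δ 0 x ω = x := by
  simpa [Phi] using (H.isSolution x hx ω).zero

theorem Phi_mem (H : SampledSystem X f Δ α φ) {x : Vec dx} (hx : x ∈ X) (τ : ℝ≥0) (ω : Vec dw) :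
    Phi φ α Δ τ x ω ∈ X :=
  (H.isSolution x hx ω).1 _

theorem continuous_Phi (H : SampledSystem X f Δ α φ) {x : Vec dx} (hx : x ∈ X) (ω : Vec dw) :
    Continuous fun τ => Phi φ α Δ τ x ω :=
  (H.isSolution x hx ω).continuous.comp (continuous_id.mul continuous_const)

theorem Phi_div (H : SampledSystem X f Δ α φ) (s : ℝ≥0) (x : Vec dx) (ω : Vec dw) :
    Phi φ α Δ (s / Δ) x ω = φ s x (constControl α Δ ω) := by
  rw [Phi, div_mul_cancel₀ _ H.pos.ne']

theorem exists_tube (H : SampledSystem X f Δ α φ) {x₀ : Vec dx} (hx₀ : x₀ ∈ X) (ω₀ : Vec dw) :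
    ∃ K ⊆ X, IsCompact K ∧ ∃ M : ℝ, ∃ η > 0, ∀ δ : ℝ, 0 ≤ δ → δ ≤ η → ∀ x ∈ X, ‖x - x₀‖ ≤ δ →
      ∀ ω, (∀ t, ‖α ω t - α ω₀ t‖ ≤ δ) → ∀ τ ≤ 1,
        Phi φ α Δ τ x ω ∈ K ∧ ‖Phi φ α Δ τ x ω - Phi φ α Δ τ x₀ ω₀‖ ≤ M * δ := by
  obtain ⟨C, hC⟩ := H.exists_norm_le ω₀
  obtain ⟨K, hKX, hK, M, η, hη, h⟩ := (H.isSolution x₀ hx₀ ω₀).exists_tube H.isOpen H.contDiffOn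
    (C := C) (Eventually.of_forall fun t _ => hC _) Δ
  exact ⟨K, hKX, hK, M, η, hη, fun δ hδ hδη x hx hxδ ω hω τ hτ =>
    h δ hδ hδη x _ _ (H.isSolution x hx ω) hxδ (Eventually.of_forall fun t _ => hω _) (τ * Δ)
      (mul_le_of_le_one_left' hτ)⟩

theorem eventually_forall_norm_Phi_sub_lt (H : SampledSystem X f Δ α φ) {x₀ : Vec dx}
    (hx₀ : x₀ ∈ X) (ω₀ : Vec dw) {ε : ℝ} (hε : 0 < ε) :
    ∀ᶠ q in 𝓝[X ×ˢ univ] (x₀, ω₀), ∀ τ ≤ 1,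
      ‖Phi φ α Δ τ q.1 q.2 - Phi φ α Δ τ x₀ ω₀‖ < ε := by
  obtain ⟨K, -, -, M, η, hη, h⟩ := H.exists_tube hx₀ ω₀
  obtain ⟨δ, hδ, hδη, hδM⟩ : ∃ δ > 0, δ ≤ η ∧ M * δ < ε := by
    -- The sign of `M` is not known here, hence `|M| + 1`.
    refine ⟨min η (ε / (2 * (|M| + 1))), by positivity, min_le_left _ _, ?_⟩
    have h1 : min η (ε / (2 * (|M| + 1))) ≤ ε / (2 * (|M| + 1)) := min_le_right _ _
    have h2 : 0 ≤ min η (ε / (2 * (|M| + 1))) := by positivity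
    rw [le_div_iff₀ (by positivity)] at h1
    nlinarith [mul_le_mul_of_nonneg_right (le_abs_self M) h2]
  have hx : ∀ᶠ q : Vec dx × Vec dw in 𝓝 (x₀, ω₀), ‖q.1 - x₀‖ < δ := by
    have := (continuous_fst.tendsto ((x₀, ω₀) : Vec dx × Vec dw)).eventually
      (Metric.ball_mem_nhds x₀ hδ)
    filter_upwards [this] with q hq
    rwa [← dist_eq_norm]
  have hω : ∀ᶠ q : Vec dx × Vec dw in 𝓝 (x₀, ω₀), ∀ t, ‖α q.2 t - α ω₀ t‖ < δ :=
    (continuous_snd.tendsto ((x₀, ω₀) : Vec dx × Vec dw)).eventually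
      (H.eventually_norm_sub_lt ω₀ δ hδ)
  filter_upwards [self_mem_nhdsWithin, nhdsWithin_le_nhds hx, nhdsWithin_le_nhds hω]
    with q hqX hqx hqω τ hτ
  exact (h δ hδ.le hδη q.1 hqX.1 (le_of_lt hqx) q.2 (fun t => (hqω t).le) τ hτ).2.trans_lt hδM

/-- Dependence on `(x, ω)` is continuous uniformly in `τ`, so continuity in `τ` of the single
trajectory from `(x₀, ω₀)` is enough. -/
theorem continuousOn_Phi (H : SampledSystem X f Δ α φ) :
    ContinuousOn (fun p : ℝ≥0 × Vec dx × Vec dw => Phi φ α Δ p.1 p.2.1 p.2.2)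
      (Icc 0 1 ×ˢ X ×ˢ univ) := by
  rintro ⟨τ₀, x₀, ω₀⟩ ⟨-, hx₀, -⟩
  have h1 : Tendsto (fun p : ℝ≥0 × Vec dx × Vec dw =>
      Phi φ α Δ p.1 p.2.1 p.2.2 - Phi φ α Δ p.1 x₀ ω₀)
      (𝓝[Icc 0 1 ×ˢ X ×ˢ univ] (τ₀, x₀, ω₀)) (𝓝 0) := by
    rw [Metric.tendsto_nhds]
    intro ε hε
    have ht : Tendsto (Prod.snd : ℝ≥0 × Vec dx × Vec dw → _)
        (𝓝[Icc 0 1 ×ˢ X ×ˢ univ] (τ₀, x₀, ω₀)) (𝓝[X ×ˢ univ] (x₀, ω₀)) :=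
      continuous_snd.continuousWithinAt.tendsto_nhdsWithin fun p hp => hp.2
    filter_upwards [ht.eventually (H.eventually_forall_norm_Phi_sub_lt hx₀ ω₀ hε),
      self_mem_nhdsWithin] with p hp hmem
    rw [dist_zero_right]
    exact hp p.1 hmem.1.2
  have h2 : Tendsto (fun p : ℝ≥0 × Vec dx × Vec dw => Phi φ α Δ p.1 x₀ ω₀)
      (𝓝[Icc 0 1 ×ˢ X ×ˢ univ] (τ₀, x₀, ω₀)) (𝓝 (Phi φ α Δ τ₀ x₀ ω₀)) :=
    ((H.continuous_Phi hx₀ ω₀).comp continuous_fst).continuousWithinAt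
  simpa [ContinuousWithinAt] using h1.add h2

theorem exists_isCompact_Phi_mem (H : SampledSystem X f Δ α φ) {K : Set (Vec dx)} (hK : IsCompact K)
    (hKX : K ⊆ X) (ω₀ : Vec dw) :
    ∃ K' ⊆ X, IsCompact K' ∧ ∀ᶠ ω in 𝓝 ω₀, ∀ x ∈ K, ∀ τ ≤ 1, Phi φ α Δ τ x ω ∈ K' := by
  -- Membership in `X` moves into the property because the sets in the compactness induction may
  -- leave `X`.
  suffices h : ∃ K' ⊆ X, IsCompact K' ∧
      ∀ᶠ ω in 𝓝 ω₀, ∀ x ∈ K, x ∈ X → ∀ τ ≤ 1, Phi φ α Δ τ x ω ∈ K' by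
    obtain ⟨K', h1, h2, h3⟩ := h
    exact ⟨K', h1, h2, h3.mono fun ω h x hx => h x hx (hKX hx)⟩
  refine hK.induction_on (p := fun s => ∃ K' ⊆ X, IsCompact K' ∧
    ∀ᶠ ω in 𝓝 ω₀, ∀ x ∈ s, x ∈ X → ∀ τ ≤ 1, Phi φ α Δ τ x ω ∈ K')
    ⟨∅, empty_subset _, isCompact_empty, by simp⟩ ?_ ?_ fun x₀ hx₀ => ?_
  · rintro s t hst ⟨K', h1, h2, h3⟩
    exact ⟨K', h1, h2, h3.mono fun ω h x hx => h x (hst hx)⟩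
  · rintro s t ⟨K₁, h1, h2, h3⟩ ⟨K₂, h4, h5, h6⟩
    refine ⟨K₁ ∪ K₂, union_subset h1 h4, h2.union h5, ?_⟩
    filter_upwards [h3, h6] with ω h7 h8
    rintro x (hx | hx) hxX τ hτ
    exacts [Or.inl (h7 x hx hxX τ hτ), Or.inr (h8 x hx hxX τ hτ)]
  · obtain ⟨K', hK'X, hK', M, η, hη, h⟩ := H.exists_tube (hKX hx₀) ω₀
    refine ⟨Metric.closedBall x₀ η, mem_nhdsWithin_of_mem_nhds (Metric.closedBall_mem_nhds _ hη),
      K', hK'X, hK', ?_⟩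
    filter_upwards [H.eventually_norm_sub_lt ω₀ η hη] with ω hω x hx hxX τ hτ
    exact (h η hη.le le_rfl x hxX (mem_closedBall_iff_norm.1 hx) ω (fun t => (hω t).le) τ hτ).1

/-- Joint continuity of the velocity at time `0`. The bound `ρ` is separate from the neighbourhood
of `(x₀, ω₀)`, so the estimate covers all of `[0, τ]` for `τ < ρ`, as averaging requires. -/
theorem exists_eventually_norm_velocity_sub_le (H : SampledSystem X f Δ α φ) {x₀ : Vec dx}
    (hx₀ : x₀ ∈ X) (ω₀ : Vec dw) {ε : ℝ} (hε : 0 < ε) :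
    ∃ ρ : ℝ≥0, 0 < ρ ∧ ∀ᶠ q in 𝓝[X ×ˢ univ] (x₀, ω₀), ∀ τ < ρ,
      ‖f (Phi φ α Δ τ q.1 q.2) (α q.2 τ) - f x₀ (α ω₀ 0)‖ ≤ ε := by
  have hI : Icc (0 : ℝ≥0) 1 ∈ 𝓝 0 := by
    rw [← bot_eq_zero, Icc_bot]
    exact Iic_mem_nhds (by simp)
  have hΦ : Tendsto (fun p : ℝ≥0 × Vec dx × Vec dw => Phi φ α Δ p.1 p.2.1 p.2.2)
      (𝓝[Icc 0 1 ×ˢ X ×ˢ univ] (0, x₀, ω₀)) (𝓝 x₀) := by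
    have := H.continuousOn_Phi (0, x₀, ω₀) ⟨by simp, hx₀, mem_univ _⟩
    rwa [ContinuousWithinAt, H.Phi_zero hx₀] at this
  have hα : Tendsto (fun p : ℝ≥0 × Vec dx × Vec dw => α p.2.2 p.1) (𝓝 (0, x₀, ω₀))
      (𝓝 (α ω₀ 0)) := by
    have h1 : Tendsto (fun p : ℝ≥0 × Vec dx × Vec dw => α p.2.2 p.1 - α ω₀ p.1)
        (𝓝 (0, x₀, ω₀)) (𝓝 0) := by
      rw [Metric.tendsto_nhds]
      intro δ hδ
      have ht : Tendsto (fun p : ℝ≥0 × Vec dx × Vec dw => p.2.2) (𝓝 (0, x₀, ω₀)) (𝓝 ω₀) :=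
        (continuous_snd.comp continuous_snd).tendsto _
      filter_upwards [ht.eventually (H.eventually_norm_sub_lt ω₀ δ hδ)] with p hp
      rw [dist_zero_right]
      exact hp _
    have h2 : Tendsto (fun p : ℝ≥0 × Vec dx × Vec dw => α ω₀ p.1) (𝓝 (0, x₀, ω₀))
        (𝓝 (α ω₀ 0)) :=
      (H.right_continuous ω₀).tendsto.comp (continuous_fst.tendsto _)
    simpa using h1.add h2
  have hfc : ContinuousAt (fun p : Vec dx × Vec du => f p.1 p.2) (x₀, α ω₀ 0) :=
    H.contDiffOn.continuousOn.continuousAt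
      ((H.isOpen.prod isOpen_univ).mem_nhds ⟨hx₀, mem_univ _⟩)
  have hF := hfc.tendsto.comp (hΦ.prodMk_nhds (hα.mono_left nhdsWithin_le_nhds))
  have hev := hF.eventually (Metric.closedBall_mem_nhds _ hε)
  rw [nhdsWithin_prod_eq, nhdsWithin_eq_nhds.2 hI, eventually_prod_iff] at hev
  obtain ⟨pa, ha, pb, hb, hab⟩ := hev
  obtain ⟨ρ, hρ, hρs⟩ := NNReal.nhds_zero_basis.mem_iff.1 ha
  refine ⟨ρ, hρ, hb.mono fun q hq τ hτ => ?_⟩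
  exact mem_closedBall_iff_norm.1 (hab (hρs hτ) hq)

theorem norm_average_sub_le (H : SampledSystem X f Δ α φ) {x v : Vec dx} (hx : x ∈ X)
    {ω : Vec dw} {τ : ℝ≥0} (hτ : τ ≠ 0) {ε : ℝ}
    (h : ∀ σ ≤ τ, ‖f (Phi φ α Δ σ x ω) (α ω σ) - v‖ ≤ ε) :
    ‖(τ : ℝ)⁻¹ • (Phi φ α Δ τ x ω - x) - (Δ : ℝ) • v‖ ≤ ε * Δ := by
  have key := (H.isSolution x hx ω).norm_sub_sub_smul_le (t := τ * Δ) (v := v) (ε := ε)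
    fun s hs => by
      have := h (s / Δ) ((div_le_iff₀ H.pos).2 hs)
      rwa [H.Phi_div] at this
  have hτ0 : (0 : ℝ) < τ := NNReal.coe_pos.2 (pos_iff_ne_zero.2 hτ)
  have e : (τ : ℝ)⁻¹ • (Phi φ α Δ τ x ω - x) - (Δ : ℝ) • v
      = (τ : ℝ)⁻¹ • (Phi φ α Δ τ x ω - x - ((τ * Δ : ℝ≥0) : ℝ) • v) := by
    rw [NNReal.coe_mul, mul_smul, smul_sub _ _ ((τ : ℝ) • (Δ : ℝ) • v), inv_smul_smul₀ hτ0.ne']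
  rw [e, norm_smul, norm_inv, Real.norm_of_nonneg hτ0.le, inv_mul_le_iff₀ hτ0]
  refine key.trans (le_of_eq ?_)
  push_cast
  ring

theorem tendsto_average (H : SampledSystem X f Δ α φ) {x : Vec dx} (hx : x ∈ X) (ω : Vec dw) :
    Tendsto (fun τ : ℝ≥0 => (τ : ℝ)⁻¹ • (Phi φ α Δ τ x ω - x)) (𝓝[>] 0)
      (𝓝 ((Δ : ℝ) • f x (α ω 0))) := by
  rw [Metric.tendsto_nhds]
  intro ε hε
  have hΔ : (0 : ℝ) < Δ := H.pos
  obtain ⟨ρ, hρ, h⟩ := H.exists_eventually_norm_velocity_sub_le hx ω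
    (ε := ε / (2 * Δ)) (by positivity)
  have hx' := h.self_of_nhdsWithin ⟨hx, mem_univ _⟩
  filter_upwards [self_mem_nhdsWithin, nhdsWithin_le_nhds (Iio_mem_nhds hρ)] with τ hτ hτρ
  rw [dist_eq_norm]
  refine (H.norm_average_sub_le hx (ne_of_gt hτ) fun σ hσ =>
    hx' σ (lt_of_le_of_lt hσ hτρ)).trans_lt ?_
  have : ε / (2 * Δ) * Δ = ε / 2 := by field_simp
  linarith

theorem Psi_zero (H : SampledSystem X f Δ α φ) {x : Vec dx} (hx : x ∈ X) (ω : Vec dw) :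
    Psi φ α Δ 0 x ω = x + (Δ : ℝ) • f x (α ω 0) := by
  rw [Psi, if_pos rfl]
  exact ((H.tendsto_average hx ω).const_add x).limUnder_eq

/-- Covering `τ = 0` as well, this gives continuity there without separating `τ = 0` from `τ > 0` in
the limit. -/
theorem norm_Psi_sub_le (H : SampledSystem X f Δ α φ) {x v : Vec dx} (hx : x ∈ X)
    {ω : Vec dw} {τ : ℝ≥0} {ε : ℝ} (h : ∀ σ ≤ τ, ‖f (Phi φ α Δ σ x ω) (α ω σ) - v‖ ≤ ε) :
    ‖Psi φ α Δ τ x ω - (x + (Δ : ℝ) • v)‖ ≤ ε * Δ := by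
  rcases eq_or_ne τ 0 with rfl | hτ
  · have := h 0 le_rfl
    rw [H.Phi_zero hx] at this
    rw [H.Psi_zero hx, add_sub_add_left_eq_sub, ← smul_sub, norm_smul, mul_comm, NNReal.norm_eq]
    exact mul_le_mul_of_nonneg_right this Δ.coe_nonneg
  · rw [Psi, if_neg hτ, add_sub_add_left_eq_sub]
    exact H.norm_average_sub_le hx hτ h

theorem continuousOn_Psi (H : SampledSystem X f Δ α φ) :
    ContinuousOn (fun p : ℝ≥0 × Vec dx × Vec dw => Psi φ α Δ p.1 p.2.1 p.2.2)
      (Icc 0 1 ×ˢ X ×ˢ univ) := by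
  rintro ⟨τ₀, x₀, ω₀⟩ hp₀
  have hx₀ : x₀ ∈ X := hp₀.2.1
  have hcx : ContinuousWithinAt (fun p : ℝ≥0 × Vec dx × Vec dw => p.2.1)
      (Icc 0 1 ×ˢ X ×ˢ univ) (τ₀, x₀, ω₀) :=
    (continuous_fst.comp continuous_snd).continuousWithinAt
  rcases eq_or_ne τ₀ 0 with rfl | hτ₀
  · set v := f x₀ (α ω₀ 0)
    have h1 : Tendsto (fun p : ℝ≥0 × Vec dx × Vec dw =>
        Psi φ α Δ p.1 p.2.1 p.2.2 - (p.2.1 + (Δ : ℝ) • v))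
        (𝓝[Icc 0 1 ×ˢ X ×ˢ univ] (0, x₀, ω₀)) (𝓝 0) := by
      rw [Metric.tendsto_nhds]
      intro ε hε
      have hΔ : (0 : ℝ) < Δ := H.pos
      obtain ⟨ρ, hρ, h⟩ := H.exists_eventually_norm_velocity_sub_le hx₀ ω₀
        (ε := ε / (2 * Δ)) (by positivity)
      have ht : Tendsto (Prod.snd : ℝ≥0 × Vec dx × Vec dw → _)
          (𝓝[Icc 0 1 ×ˢ X ×ˢ univ] (0, x₀, ω₀)) (𝓝[X ×ˢ univ] (x₀, ω₀)) :=
        continuous_snd.continuousWithinAt.tendsto_nhdsWithin fun p hp => hp.2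
      have ht' : Tendsto (Prod.fst : ℝ≥0 × Vec dx × Vec dw → _)
          (𝓝[Icc 0 1 ×ˢ X ×ˢ univ] (0, x₀, ω₀)) (𝓝 0) :=
        continuous_fst.continuousWithinAt
      filter_upwards [ht.eventually h, ht'.eventually (Iio_mem_nhds hρ), self_mem_nhdsWithin]
        with p hp hpρ hmem
      rw [dist_zero_right]
      refine (H.norm_Psi_sub_le hmem.2.1 fun σ hσ => hp σ (lt_of_le_of_lt hσ hpρ)).trans_lt ?_
      have : ε / (2 * Δ) * Δ = ε / 2 := by field_simp
      linarith
    have h2 := h1.add (hcx.tendsto.add_const ((Δ : ℝ) • v))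
    simpa [ContinuousWithinAt, H.Psi_zero hx₀, v] using h2
  · have hc : ContinuousWithinAt (fun p : ℝ≥0 × Vec dx × Vec dw =>
        p.2.1 + (p.1 : ℝ)⁻¹ • (Phi φ α Δ p.1 p.2.1 p.2.2 - p.2.1))
        (Icc 0 1 ×ˢ X ×ˢ univ) (τ₀, x₀, ω₀) :=
      hcx.add (((NNReal.continuous_coe.comp continuous_fst).continuousWithinAt.inv₀
        (NNReal.coe_ne_zero.2 hτ₀)).smul ((H.continuousOn_Phi _ hp₀).sub hcx))
    refine hc.congr_of_eventuallyEq ?_ (by rw [Psi, if_neg hτ₀])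
    have : ∀ᶠ p : ℝ≥0 × Vec dx × Vec dw in 𝓝 (τ₀, x₀, ω₀), p.1 ≠ 0 :=
      continuous_fst.continuousAt.eventually_ne hτ₀
    filter_upwards [nhdsWithin_le_nhds this] with p hp
    rw [Psi, if_neg hp]

theorem exists_eventually_norm_Psi_sub_le (H : SampledSystem X f Δ α φ) {K : Set (Vec dx)}
    (hK : IsCompact K) (hKX : K ⊆ X) (ω₀ : Vec dw) :
    ∃ C : ℝ≥0, ∀ᶠ ω in 𝓝 ω₀, ∀ τ ∈ Icc (0 : ℝ≥0) 1, ∀ x₁ ∈ K, ∀ x₂ ∈ K,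
      ‖Psi φ α Δ τ x₂ ω - Psi φ α Δ τ x₁ ω‖ ≤ C * ‖x₂ - x₁‖ := by
  obtain ⟨K', hK'X, hK', hmem⟩ := H.exists_isCompact_Phi_mem hK hKX ω₀
  obtain ⟨C, hC⟩ := H.exists_norm_le ω₀
  obtain ⟨L, hL⟩ := exists_lipschitzOnWith_prod_closedBall H.isOpen H.contDiffOn hK' hK'X (C + 1)
  set E : ℝ≥0 := ⟨Real.exp (L * Δ), (Real.exp_pos _).le⟩ with hE
  -- The `1` comes from the summand `x` of `Ψ`; trajectories separate by at most the factor `E`,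
  -- velocities by `L * E`, and `Δ` multiplies the average velocity.
  refine ⟨1 + Δ * (L * E), ?_⟩
  filter_upwards [hmem, H.eventually_norm_sub_lt ω₀ 1 one_pos] with ω hωK hω τ hτ x₁ hx₁ x₂ hx₂
  have hB : ∀ t, α ω t ∈ Metric.closedBall (0 : Vec du) (C + 1) := fun t => by
    rw [mem_closedBall_zero_iff]
    linarith [hω t, hC t, norm_le_norm_add_norm_sub' (α ω t) (α ω₀ t)]
  have hs₁ := H.isSolution x₁ (hKX hx₁) ω
  have hs₂ := H.isSolution x₂ (hKX hx₂) ω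
  have hmemφ : ∀ x ∈ K, ∀ s ≤ Δ, φ s x (constControl α Δ ω) ∈ K' := fun x hx s hs => by
    rw [← H.Phi_div]
    exact hωK x hx _ ((div_le_one₀ H.pos).2 hs)
  have hdist : ∀ s ≤ Δ, ‖φ s x₂ (constControl α Δ ω) - φ s x₁ (constControl α Δ ω)‖
      ≤ E * ‖x₂ - x₁‖ := fun s hs => by
    have := hs₂.norm_sub_le hL hs₁ (T := Δ) (hmemφ x₂ hx₂) (hmemφ x₁ hx₁)
      (Eventually.of_forall fun t _ => hB _) (Eventually.of_forall fun t _ => hB _) (δ := 0)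
      (by simp) le_rfl s hs
    rw [mul_zero, zero_mul, add_zero, mul_comm] at this
    refine this.trans (mul_le_mul_of_nonneg_right ?_ (norm_nonneg _))
    exact Real.exp_le_exp.2 (mul_le_mul_of_nonneg_left (NNReal.coe_le_coe.2 hs) L.coe_nonneg)
  have hvel : ∀ s ≤ Δ, ‖f (φ s x₂ (constControl α Δ ω)) (constControl α Δ ω s)
      - f (φ s x₁ (constControl α Δ ω)) (constControl α Δ ω s)‖ ≤ L * (E * ‖x₂ - x₁‖) :=
    fun s hs => by
      refine (hL.norm_sub_le_add (hmemφ x₂ hx₂ s hs) (hmemφ x₁ hx₁ s hs) (hB _) (hB _)).trans ?_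
      rw [sub_self, norm_zero, add_zero]
      exact mul_le_mul_of_nonneg_left (hdist s hs) L.coe_nonneg
  push_cast
  rcases eq_or_ne τ 0 with rfl | hτ0
  · have h0 := hvel 0 zero_le
    have e₁ : φ 0 x₁ (constControl α Δ ω) = x₁ := hs₁.zero
    have e₂ : φ 0 x₂ (constControl α Δ ω) = x₂ := hs₂.zero
    rw [e₁, e₂, constControl, zero_div] at h0
    rw [H.Psi_zero (hKX hx₁), H.Psi_zero (hKX hx₂), add_sub_add_comm, ← smul_sub]
    refine (norm_add_le _ _).trans ?_
    rw [norm_smul, NNReal.norm_eq]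
    have := mul_le_mul_of_nonneg_left h0 Δ.coe_nonneg
    linarith
  · have hτpos : (0 : ℝ) < τ := NNReal.coe_pos.2 (pos_iff_ne_zero.2 hτ0)
    have hinc := hs₂.norm_sub_sub_sub_le hs₁ (t := τ * Δ)
      fun s hs => hvel s (hs.trans (mul_le_of_le_one_left' hτ.2))
    have e : Psi φ α Δ τ x₂ ω - Psi φ α Δ τ x₁ ω = (x₂ - x₁)
        + (τ : ℝ)⁻¹ • ((Phi φ α Δ τ x₂ ω - x₂) - (Phi φ α Δ τ x₁ ω - x₁)) := by
      rw [Psi, Psi, if_neg hτ0, if_neg hτ0, smul_sub _ (Phi φ α Δ τ x₂ ω - x₂)]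
      abel
    have hinc' : ‖(τ : ℝ)⁻¹ • ((Phi φ α Δ τ x₂ ω - x₂) - (Phi φ α Δ τ x₁ ω - x₁))‖
        ≤ Δ * (L * (E * ‖x₂ - x₁‖)) := by
      rw [norm_smul, norm_inv, Real.norm_of_nonneg hτpos.le, inv_mul_le_iff₀ hτpos]
      refine hinc.trans (le_of_eq ?_)
      push_cast
      ring
    rw [e]
    refine (norm_add_le _ _).trans ?_
    linarith

/-- Take for `ν` the least constant valid for all `τ` at the given `ω`: the valid constants form a
closed set, so the infimum is attained, and it lies below every local bound. -/
theorem exists_locallyBoundedOn_norm_Psi_sub_le (H : SampledSystem X f Δ α φ) {K : Set (Vec dx)}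
    (hK : IsCompact K) (hKX : K ⊆ X) : ∃ ν : ℝ≥0 × Vec dw → ℝ≥0,
      LocallyBoundedOn ν (Icc 0 1 ×ˢ univ) ∧
      ∀ τ ∈ Icc (0 : ℝ≥0) 1, ∀ ω, ∀ x₁ ∈ K, ∀ x₂ ∈ K,
        ‖Psi φ α Δ τ x₂ ω - Psi φ α Δ τ x₁ ω‖ ≤ ν (τ, ω) * ‖x₂ - x₁‖ := by
  set S : Vec dw → Set ℝ≥0 := fun ω => {C | ∀ τ ∈ Icc (0 : ℝ≥0) 1, ∀ x₁ ∈ K, ∀ x₂ ∈ K,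
    ‖Psi φ α Δ τ x₂ ω - Psi φ α Δ τ x₁ ω‖ ≤ C * ‖x₂ - x₁‖} with hS
  have hev : ∀ ω₀, ∃ C, ∀ᶠ ω in 𝓝 ω₀, C ∈ S ω := H.exists_eventually_norm_Psi_sub_le hK hKX
  have hclosed : ∀ ω, IsClosed (S ω) := fun ω => by
    simp only [hS, ofPred_forall]
    refine isClosed_iInter fun τ => isClosed_iInter fun _ => isClosed_iInter fun x₁ =>
      isClosed_iInter fun _ => isClosed_iInter fun x₂ => isClosed_iInter fun _ => ?_
    exact isClosed_le continuous_const (NNReal.continuous_coe.mul continuous_const)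
  have hmem : ∀ ω, sInf (S ω) ∈ S ω := fun ω => by
    obtain ⟨C, hC⟩ := hev ω
    exact (hclosed ω).csInf_mem ⟨C, hC.self_of_nhds⟩ (OrderBot.bddBelow _)
  refine ⟨fun p => sInf (S p.2), ?_, fun τ hτ ω => hmem ω τ hτ⟩
  rintro ⟨τ₀, ω₀⟩ -
  obtain ⟨C, hC⟩ := hev ω₀
  refine ⟨C, nhdsWithin_le_nhds ?_⟩
  filter_upwards [(continuous_snd.tendsto (τ₀, ω₀)).eventually hC] with p hp
  exact csInf_le (OrderBot.bddBelow _) hp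

end SampledSystem

end Sampled

theorem lemma1 {dx du dw : ℕ} (X : Set (Vec dx)) (hX : IsOpen X)
    (f : Vec dx → Vec du → Vec dx) (Δ : ℝ≥0) (hΔ : 0 < Δ) (α : Vec dw → ℝ≥0 → Vec du)
    (hα_periodic : ∀ ω, Function.Periodic (α ω) 1)
    (hα_measurable : Measurable (Function.uncurry α))
    (hα_bounded : ∀ ω, Bornology.IsBounded (α ω '' Icc 0 1))
    (hα_right_continuous : ∀ ω, ContinuousWithinAt (α ω) (Ici 0) 0)
    (hα_equicontinuous : Equicontinuous (fun (t : Ico (0 : ℝ≥0) 1) (ω : Vec dw) => α ω t))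
    (hf : ContDiffOn ℝ 1 (fun p : Vec dx × Vec du => f p.1 p.2) (X ×ˢ univ))
    (hf_complete : ForwardComplete f X) :
    (∃ φ, IsODEFlow f X φ) ∧
    (∀ φ ψ, IsODEFlow f X φ → IsODEFlow f X ψ →
      ∀ t, ∀ x ∈ X, ∀ u ∈ admissibleControls du, φ t x u = ψ t x u) ∧
    ∀ φ, IsODEFlow f X φ →
      IsControlFlow X (admissibleControls du) φ ∧
      FlowHypotheses X (admissibleControls du) α Δ φ := by
  refine ⟨hf_complete.exists_isODEFlow, fun φ ψ hφ hψ t x hx u hu =>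
    congrFun ((hφ x hx u hu).eq hX hf hu (hψ x hx u hu)) t,
    fun φ hφ => ⟨hφ.isControlFlow hX hf, ?_⟩⟩
  have H : SampledSystem X f Δ α φ :=
    { isOpen := hX
      contDiffOn := hf
      pos := hΔ
      exists_norm_le := exists_forall_norm_le_of_periodic hα_periodic hα_bounded
      -- In `ℝ≥0` the set `Ici 0` is everything, so right-continuity at `0` is continuity.
      right_continuous := fun ω => (hα_right_continuous ω).continuousAt 
        (mem_of_superset univ_mem fun _ _ => mem_Ici.2 zero_le)
      eventually_norm_sub_lt := fun ω₀ ε hε =>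
        eventually_forall_norm_sub_lt_of_periodic hα_periodic hα_equicontinuous ω₀ hε
      isSolution := fun x hx ω => hφ x hx _
        (constControl_mem_admissibleControls hα_periodic hα_measurable hα_bounded Δ ω) }
  exact
    { controls := fun K hK => controlSet_subset_admissibleControls hα_periodic hα_measurable
        hα_bounded hα_equicontinuous hΔ hK
      right_differentiable := fun x hx ω => ⟨_, by
        simpa only [H.Phi_zero hx] using H.tendsto_average hx ω⟩
      continuous := H.continuousOn_Psi
      locally_lipschitz := fun K hKX hK => H.exists_locallyBoundedOn_norm_Psi_sub_le hK hKX }
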